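/- Let $I,J,R$ be integers with $I>J\ge 2$ and $\min(I,2J)>R>J$. The rank of a real three-way array is the smallest number of rank-1 arrays (outer products $\mathbf a\circ\mathbf b\circ\mathbf c$ of three nonzero real vectors, with entries $a_ib_jc_k$) whose sum equals it. For $\mathcal Y\in\mathbb R^{I\times J\times 2}$ with frontal $I\times J$ slices $\mathbf Y_1,\mathbf Y_2$ let $[\mathbf Y_1\,|\,\mathbf Y_2]$ be its $I\times 2J$ matrix unfolding, let $\|\mathcal Y\|_F$ be its Frobenius norm (the square root of the sum of the squares of its entries), and put $$W_R(I,J,2)=\{\mathcal Y\in\mathbb R^{I\times J\times 2}:\ \operatorname{rank}([\mathbf Y_1\,|\,\mathbf Y_2])\le R\}.$$ Then for generic $\mathcal Z\in\mathbb R^{I\times J\times 2}$, that is, for all $\mathcal Z$ outside a set of Lebesgue measure zero, the problem $$\min_{\mathcal Y\in W_R(I,J,2)}\|\mathcal Z-\mathcal Y\|_F^2$$ has exactly one optimal solution $\mathcal X$, and $\mathcal X$ has (tensor) rank exactly $R$. -/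

import Mathlib

/-- Real `I × J × K` arrays; the entry `y_{ijk}` of `Y` is `Y (i, j, k)`. As a function space on a
finite index type it carries the usual Lebesgue measure `volume`. -/
abbrev ThreeWayArray (I J K : ℕ) : Type := Fin I × Fin J × Fin K → ℝ

namespace ThreeWayArray

variable {I J K : ℕ}

/-- The outer vector product `a ∘ b ∘ c`. -/
def outer (a : Fin I → ℝ) (b : Fin J → ℝ) (c : Fin K → ℝ) : ThreeWayArray I J K :=
  fun p => a p.1 * b p.2.1 * c p.2.2

/-- Rank-1 arrays: outer products of three nonzero vectors. -/
def IsRankOne (Y : ThreeWayArray I J K) : Prop :=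
  ∃ (a : Fin I → ℝ) (b : Fin J → ℝ) (c : Fin K → ℝ),
    a ≠ 0 ∧ b ≠ 0 ∧ c ≠ 0 ∧ Y = outer a b c

/-- `Y` is a sum of exactly `n` rank-1 arrays. -/
def IsSumOfRankOnes (Y : ThreeWayArray I J K) (n : ℕ) : Prop :=
  ∃ T : Fin n → ThreeWayArray I J K, (∀ r, IsRankOne (T r)) ∧ Y = ∑ r, T r

/-- Every array is a finite sum of rank-1 arrays, so that the infimum in `rank` is a minimum. -/
theorem exists_isSumOfRankOnes (Y : ThreeWayArray I J K) : ∃ n, IsSumOfRankOnes Y n := by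
  classical
  have key : ∀ p, Y p ≠ 0 → IsRankOne (Pi.single p (Y p) : ThreeWayArray I J K) := by
    rintro ⟨i, j, k⟩ hY
    refine ⟨Pi.single i (Y (i, j, k)), Pi.single j 1, Pi.single k 1, ?_, ?_, ?_, ?_⟩
    · simpa using hY
    · simp
    · simp
    · funext ⟨i', j', k'⟩
      by_cases h1 : i' = i <;> by_cases h2 : j' = j <;> by_cases h3 : k' = k <;>
        simp [outer, h1, h2, h3]
  let s : Finset (Fin I × Fin J × Fin K) := Finset.univ.filter fun p => Y p ≠ 0
  refine ⟨s.card, fun r => Pi.single (s.equivFin.symm r : Fin I × Fin J × Fin K)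
    (Y (s.equivFin.symm r)), fun r => ?_, ?_⟩
  · exact key _ (Finset.mem_filter.1 (s.equivFin.symm r).2).2
  · rw [Equiv.sum_comp s.equivFin.symm
      (fun q : s => (Pi.single (q : Fin I × Fin J × Fin K) (Y q) : ThreeWayArray I J K)),
      Finset.sum_coe_sort s
      (fun q => (Pi.single q (Y q) : ThreeWayArray I J K))]
    funext p
    simp only [Finset.sum_apply, Pi.single_apply]
    by_cases h : Y p = 0 <;> simp [s, h]

/-- The (tensor) rank: the smallest number of rank-1 arrays whose sum is `Y`. -/
noncomputable def rank (Y : ThreeWayArray I J K) : ℕ := sInf {n | IsSumOfRankOnes Y n}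

/-- The rank is attained and minimal. -/
theorem isLeast_rank (Y : ThreeWayArray I J K) : IsLeast {n | IsSumOfRankOnes Y n} Y.rank :=
  ⟨Nat.sInf_mem (exists_isSumOfRankOnes Y), fun _ h => Nat.sInf_le h⟩

/-- The Frobenius norm: the square root of the sum of the squares of the entries. -/
noncomputable def frobeniusNorm (Y : ThreeWayArray I J K) : ℝ := √(∑ p, Y p ^ 2)

/-- The `k`-th frontal slice, an `I × J` matrix. -/
def slice (Y : ThreeWayArray I J K) (k : Fin K) : Matrix (Fin I) (Fin J) ℝ :=
  Matrix.of fun i j => Y (i, j, k)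

/-- The `I × 2J` matrix unfolding `[Y₁ | Y₂]` of an `I × J × 2` array. -/
def unfolding (Y : ThreeWayArray I J 2) : Matrix (Fin I) (Fin J ⊕ Fin J) ℝ :=
  Matrix.fromCols (Y.slice 0) (Y.slice 1)

/-- The set `W_R(I,J,2)`: the unfolding has matrix rank at most `R`. -/
def W (I J R : ℕ) : Set (ThreeWayArray I J 2) := {Y | Y.unfolding.rank ≤ R}

/-- `X` is an optimal solution of the problem of minimizing `‖Z - Y‖_F²` over `Y ∈ W_R(I,J,2)`. -/
def IsOptimalSolution (R : ℕ) (Z X : ThreeWayArray I J 2) : Prop :=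
  X ∈ W I J R ∧ ∀ Y ∈ W I J R, frobeniusNorm (Z - X) ^ 2 ≤ frobeniusNorm (Z - Y) ^ 2

end ThreeWayArray

/-! Uniqueness: the distance to `W I J R` is Lipschitz, so differentiable almost everywhere by
Rademacher. Where it is, the gradient of its square is 2(Z - X) for every nearest point X, which
determines X.

Rank: generically the unfolding of Z has rank at least R, hence that of X has rank exactly R, and
the tensor rank is at least R. For the converse it suffices that the row space of the unfolding of X
is spanned by rank-1 J × 2 matrices. Up to permutations of rows and columns the unfolding is [1; E]
A [1 | C] with A invertible, and its row space is the kernel of the pencil [-Cᵀ | 1] with d = 2J - R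
< J rows. This kernel is spanned by rank-1 matrices when the pencil is controllable
(`kernelSpannedByOuter_of_controllable`), which holds wherever the nonzero polynomial
`pencilInvariant` does not vanish.

Genericity passes from C to Z because the residual has the form [-Eᵀ; 1] D [-Cᵀ | 1]. Thus Z is the
value of `normalMap` at (A, C, E, D), and this differentiable map between spaces of equal dimension
sends the null set of bad C to a null set. -/

open Matrix MeasureTheory

/-! ### Polynomial functions and their zero sets -/

/-- Continuous functions whose restriction to every line is a polynomial function. -/
def PolynomialOnLines {E : Type*} [AddCommGroup E] [Module ℝ E] [TopologicalSpace E]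
    (f : E → ℝ) : Prop :=
  Continuous f ∧ ∀ x y : E, ∃ p : Polynomial ℝ, ∀ t : ℝ, f (x + t • y) = p.eval t

namespace PolynomialOnLines

section Closure

variable {E : Type*} [AddCommGroup E] [Module ℝ E] [TopologicalSpace E] {f g : E → ℝ}

theorem const (c : ℝ) : PolynomialOnLines (fun _ : E => c) :=
  ⟨continuous_const, fun _ _ => ⟨Polynomial.C c, fun t => by simp⟩⟩

theorem add (hf : PolynomialOnLines f) (hg : PolynomialOnLines g) :
    PolynomialOnLines (fun x => f x + g x) := by
  refine ⟨hf.1.add hg.1, fun x y => ?_⟩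
  obtain ⟨p, hp⟩ := hf.2 x y
  obtain ⟨q, hq⟩ := hg.2 x y
  exact ⟨p + q, fun t => by simp [hp, hq]⟩

theorem mul (hf : PolynomialOnLines f) (hg : PolynomialOnLines g) :
    PolynomialOnLines (fun x => f x * g x) := by
  refine ⟨hf.1.mul hg.1, fun x y => ?_⟩
  obtain ⟨p, hp⟩ := hf.2 x y
  obtain ⟨q, hq⟩ := hg.2 x y
  exact ⟨p * q, fun t => by simp [hp, hq]⟩

theorem neg (hf : PolynomialOnLines f) : PolynomialOnLines (fun x => -f x) := by
  simpa using (const (-1)).mul hf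

theorem sub (hf : PolynomialOnLines f) (hg : PolynomialOnLines g) :
    PolynomialOnLines (fun x => f x - g x) := by
  simpa [sub_eq_add_neg] using hf.add hg.neg

theorem sum {ι : Type*} (s : Finset ι) {f : ι → E → ℝ}
    (h : ∀ i ∈ s, PolynomialOnLines (f i)) : PolynomialOnLines (fun x => ∑ i ∈ s, f i x) := by
  classical
  induction s using Finset.induction_on with
  | empty => simpa using const 0
  | insert a s ha ih =>
    simp only [Finset.sum_insert ha]
    exact (h a (by simp)).add (ih fun i hi => h i (by simp [hi]))

theorem prod {ι : Type*} (s : Finset ι) {f : ι → E → ℝ}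
    (h : ∀ i ∈ s, PolynomialOnLines (f i)) : PolynomialOnLines (fun x => ∏ i ∈ s, f i x) := by
  classical
  induction s using Finset.induction_on with
  | empty => simpa using const 1
  | insert a s ha ih =>
    simp only [Finset.prod_insert ha]
    exact (h a (by simp)).mul (ih fun i hi => h i (by simp [hi]))

theorem apply {ι : Type*} (i : ι) : PolynomialOnLines (fun x : ι → ℝ => x i) :=
  ⟨continuous_apply i, fun x y =>
    ⟨Polynomial.C (x i) + Polynomial.X * Polynomial.C (y i), fun t => by simp; ring⟩⟩

variable {l m n : Type*} [Fintype m]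

theorem matrix_mul {A : E → Matrix l m ℝ} {B : E → Matrix m n ℝ}
    (hA : ∀ i j, PolynomialOnLines (fun x => A x i j))
    (hB : ∀ i j, PolynomialOnLines (fun x => B x i j)) (i : l) (j : n) :
    PolynomialOnLines (fun x => (A x * B x) i j) := by
  simp only [Matrix.mul_apply]
  exact sum _ fun k _ => (hA i k).mul (hB k j)

theorem mulVec {A : E → Matrix l m ℝ} {v : E → m → ℝ}
    (hA : ∀ i j, PolynomialOnLines (fun x => A x i j))
    (hv : ∀ j, PolynomialOnLines (fun x => v x j)) (i : l) :
    PolynomialOnLines (fun x => (A x).mulVec (v x) i) := by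
  simp only [Matrix.mulVec, dotProduct]
  exact sum _ fun k _ => (hA i k).mul (hv k)

theorem det [Fintype n] [DecidableEq n] {A : E → Matrix n n ℝ}
    (hA : ∀ i j, PolynomialOnLines (fun x => A x i j)) :
    PolynomialOnLines (fun x => (A x).det) := by
  simp only [Matrix.det_apply']
  exact sum _ fun σ _ => (const _).mul (prod _ fun i _ => hA _ _)

theorem adjugate [Fintype n] [DecidableEq n] {A : E → Matrix n n ℝ}
    (hA : ∀ i j, PolynomialOnLines (fun x => A x i j)) (i j : n) :
    PolynomialOnLines (fun x => (A x).adjugate i j) := by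
  simp only [Matrix.adjugate_apply]
  refine det fun a b => ?_
  by_cases h : a = j
  · subst h; simpa using const _
  · simpa [Matrix.updateRow_apply, h] using hA a b

theorem pow_mulVec [Fintype n] [DecidableEq n] {A : E → Matrix n n ℝ} {v : E → n → ℝ}
    (hA : ∀ i j, PolynomialOnLines (fun x => A x i j))
    (hv : ∀ j, PolynomialOnLines (fun x => v x j)) (k : ℕ) (i : n) :
    PolynomialOnLines (fun x => (A x ^ k).mulVec (v x) i) := by
  induction k generalizing i with
  | zero => simpa using hv i
  | succ k ih =>
    simp only [pow_succ', ← Matrix.mulVec_mulVec]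
    exact mulVec hA ih i

end Closure

/-- Two functions that are polynomial on lines and do not vanish identically do not vanish at a
common point. -/
theorem exists_ne_zero {E : Type*} [AddCommGroup E] [Module ℝ E] [TopologicalSpace E]
    {f g : E → ℝ} (hf : PolynomialOnLines f) (hg : PolynomialOnLines g) {a b : E}
    (ha : f a ≠ 0) (hb : g b ≠ 0) : ∃ x, f x ≠ 0 ∧ g x ≠ 0 := by
  obtain ⟨p, hp⟩ := hf.2 a (b - a)
  obtain ⟨q, hq⟩ := hg.2 a (b - a)
  have hp0 : p ≠ 0 := by
    rintro rfl
    exact ha (by simpa using hp 0)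
  have hq0 : q ≠ 0 := by
    rintro rfl
    exact hb (by simpa using hq 1)
  obtain ⟨t, ht⟩ : ∃ t, (p * q).eval t ≠ 0 := by
    by_contra! h
    exact mul_ne_zero hp0 hq0 (Polynomial.funext (by simpa using h))
  rw [Polynomial.eval_mul] at ht
  exact ⟨a + t • (b - a), by rw [hp]; exact left_ne_zero_of_mul ht,
    by rw [hq]; exact right_ne_zero_of_mul ht⟩

/-- On each line through `x₀` the function is a nonzero polynomial, with finitely many zeros. By
Fubini some dilation about `x₀` with factor `t ≠ 0` pulls the zero set back to a null set, and
dilations and translations preserve null sets. -/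
theorem ae_ne_zero {E : Type*} [NormedAddCommGroup E] [NormedSpace ℝ E] [FiniteDimensional ℝ E]
    [MeasurableSpace E] [BorelSpace E] (μ : Measure E) [μ.IsAddHaarMeasure] {f : E → ℝ}
    (hf : PolynomialOnLines f) {x₀ : E} (h₀ : f x₀ ≠ 0) : ∀ᵐ x ∂μ, f x ≠ 0 := by
  have hmeas : MeasurableSet {q : E × ℝ | f (x₀ + q.2 • q.1) ≠ 0} := by
    refine (isOpen_ne_fun (hf.1.comp ?_) continuous_const).measurableSet
    fun_prop
  have h1 : ∀ᵐ y ∂μ, ∀ᵐ t ∂(volume : Measure ℝ), f (x₀ + t • y) ≠ 0 := by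
    refine Filter.Eventually.of_forall fun y => ?_
    obtain ⟨p, hp⟩ := hf.2 x₀ y
    have hp0 : p ≠ 0 := by
      rintro rfl
      exact h₀ (by simpa using hp 0)
    have hfin : {t : ℝ | p.eval t = 0}.Finite := by
      simpa [Polynomial.IsRoot] using Polynomial.finite_setOfPred_isRoot hp0
    simp only [hp]
    exact measure_mono_null (fun t ht => by simpa using ht) (hfin.measure_zero volume)
  rw [Measure.ae_ae_comm hmeas] at h1
  have h2 : ∀ᵐ t ∂(volume : Measure ℝ), t ≠ 0 := by
    simp [ae_iff]
  obtain ⟨t, ht, ht0⟩ := (h1.and h2).exists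
  rw [ae_iff] at ht ⊢
  have h3 : {a : E | ¬ f (x₀ + t • a) ≠ 0} =
      (fun y => t • y) ⁻¹' ((fun x => x₀ + x) ⁻¹' {x | ¬ f x ≠ 0}) := rfl
  rw [h3, Measure.addHaar_preimage_smul μ ht0, measure_preimage_add] at ht
  rcases mul_eq_zero.1 ht with h | h
  · simp [ht0] at h
  · exact h

end PolynomialOnLines

/-! ### Controllable pencils and rank-1 matrices in their kernels -/

theorem Continuous.eq_zero_of_forall_ne_zero {g : ℝ → ℝ} (hg : Continuous g)
    (h : ∀ s, s ≠ 0 → g s = 0) (s : ℝ) : g s = 0 := by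
  have : g = fun _ => 0 :=
    hg.ext_on (dense_compl_singleton (0 : ℝ)) continuous_const fun s hs => h s hs
  simp [this]

/-- If a row vector annihilates `adj (1 + s M) w` for all `s`, then it annihilates the Krylov
space of `M` generated by `w`. -/
theorem Matrix.dotProduct_pow_mulVec_eq_zero {d : Type*} [Fintype d] [DecidableEq d]
    (M : Matrix d d ℝ) (w a : d → ℝ)
    (h : ∀ s : ℝ, a ⬝ᵥ ((1 + s • M).adjugate *ᵥ w) = 0) (k : ℕ) : a ⬝ᵥ (M ^ k *ᵥ w) = 0 := by
  induction k generalizing a with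
  | zero => simpa using h 0
  | succ k ih =>
    rw [pow_succ', ← mulVec_mulVec, dotProduct_mulVec]
    refine ih _ ?_
    -- It remains to see that `a ᵥ* M` inherits the hypothesis: pairing `a` with (1 + sM) adj(1 +
    -- sM) w = det(1 + sM) w leaves only a term divisible by s.
    refine Continuous.eq_zero_of_forall_ne_zero (by fun_prop) fun s hs => ?_
    have h0 : a ⬝ᵥ w = 0 := by simpa using h 0
    have h1 : (1 + s • M) *ᵥ ((1 + s • M).adjugate *ᵥ w) = (1 + s • M).det • w := by
      rw [mulVec_mulVec, mul_adjugate, smul_mulVec, one_mulVec]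
    have h2 := congrArg (a ⬝ᵥ ·) h1
    simp only [add_mulVec, one_mulVec, dotProduct_add, h s, smul_mulVec, dotProduct_smul, h0,
      smul_eq_mul, mul_zero, zero_add, mul_eq_zero, hs, false_or] at h2
    rwa [← dotProduct_mulVec]

/-- The kernel of `[W₁ | W₂]` is spanned by the vectors `(s x, x)` in it, if the pencil is
controllable: a linear form that vanishes on the latter vanishes on the kernel. -/
theorem Matrix.dotProduct_add_eq_zero_of_controllable {n d : Type*} [Fintype n] [Fintype d]
    [DecidableEq d] (W₁ W₂ : Matrix d n ℝ) (S : Matrix n d ℝ) (z : n → ℝ)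
    (hS : W₂ * S = 1) (hz : W₂ *ᵥ z = 0)
    (hctrl : ∀ a : d → ℝ, (∀ k : ℕ, a ⬝ᵥ ((W₁ * S) ^ k *ᵥ (W₁ *ᵥ z)) = 0) → a = 0)
    (α β : n → ℝ)
    (h : ∀ (s : ℝ) (x : n → ℝ), (s • W₁ + W₂) *ᵥ x = 0 → s * (α ⬝ᵥ x) + β ⬝ᵥ x = 0)
    (y₁ y₂ : n → ℝ) (hy : W₁ *ᵥ y₁ + W₂ *ᵥ y₂ = 0) : α ⬝ᵥ y₁ + β ⬝ᵥ y₂ = 0 := by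
  set M := W₁ * S with hM
  have hρ : ∀ (s : ℝ) (w : d → ℝ), (1 + s • M).adjugate *ᵥ w =
      (1 + s • M).det • w - s • (M *ᵥ ((1 + s • M).adjugate *ᵥ w)) := by
    intro s w
    have h1 : (1 + s • M) *ᵥ ((1 + s • M).adjugate *ᵥ w) = (1 + s • M).det • w := by
      rw [mulVec_mulVec, mul_adjugate, smul_mulVec, one_mulVec]
    rw [← h1, add_mulVec, one_mulVec, smul_mulVec]
    abel
  -- For k in the kernel of `W₂`, Cramer's rule for 1 + sM gives an explicit polynomial curve x(s)
  -- in the kernel of sW₁ + W₂ with x(0) = k.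
  have key : ∀ k : n → ℝ, W₂ *ᵥ k = 0 → ∀ s : ℝ,
      s * (α ⬝ᵥ ((1 + s • M).det • k - s • (S *ᵥ ((1 + s • M).adjugate *ᵥ (W₁ *ᵥ k))))) +
        β ⬝ᵥ ((1 + s • M).det • k - s • (S *ᵥ ((1 + s • M).adjugate *ᵥ (W₁ *ᵥ k)))) = 0 := by
    intro k hk s
    refine h s _ ?_
    have h1 : W₁ *ᵥ (S *ᵥ ((1 + s • M).adjugate *ᵥ (W₁ *ᵥ k))) =
        M *ᵥ ((1 + s • M).adjugate *ᵥ (W₁ *ᵥ k)) := by rw [mulVec_mulVec]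
    have h2 : W₂ *ᵥ (S *ᵥ ((1 + s • M).adjugate *ᵥ (W₁ *ᵥ k))) =
        (1 + s • M).adjugate *ᵥ (W₁ *ᵥ k) := by rw [mulVec_mulVec, hS, one_mulVec]
    rw [add_mulVec, smul_mulVec, mulVec_sub, mulVec_sub, mulVec_smul, mulVec_smul, mulVec_smul,
      mulVec_smul, hk, h1, h2]
    nth_rewrite 2 [hρ s]
    module
  have hβ : ∀ k : n → ℝ, W₂ *ᵥ k = 0 → β ⬝ᵥ k = 0 := fun k hk => by simpa using key k hk 0
  have key2 : ∀ k : n → ℝ, W₂ *ᵥ k = 0 → ∀ s : ℝ,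
      (1 + s • M).det * (α ⬝ᵥ k) - s * (α ⬝ᵥ (S *ᵥ ((1 + s • M).adjugate *ᵥ (W₁ *ᵥ k)))) -
        β ⬝ᵥ (S *ᵥ ((1 + s • M).adjugate *ᵥ (W₁ *ᵥ k))) = 0 := by
    intro k hk
    refine Continuous.eq_zero_of_forall_ne_zero (by fun_prop) fun s hs => ?_
    have := key k hk s
    simp only [dotProduct_sub, dotProduct_smul, hβ k hk, smul_eq_mul] at this
    refine (mul_eq_zero.1 (?_ : s * _ = 0)).resolve_left hs
    linarith
  have hα : ∀ k : n → ℝ, W₂ *ᵥ k = 0 → α ⬝ᵥ k = β ⬝ᵥ (S *ᵥ (W₁ *ᵥ k)) := fun k hk => by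
    simpa [sub_eq_zero] using key2 k hk 0
  -- On the curve through `z`, the relation from `hρ` turns the identity into s times this row
  -- vector paired with adj(1 + sM) W₁z. Controllability then makes the vector vanish.
  have ha : (β ᵥ* S) ᵥ* M - α ᵥ* S = 0 := by
    refine hctrl _ (dotProduct_pow_mulVec_eq_zero M _ _ ?_)
    refine Continuous.eq_zero_of_forall_ne_zero (by fun_prop) fun s hs => ?_
    have h1 := key2 z hz s
    have h2 := congrArg (fun v => β ⬝ᵥ (S *ᵥ v)) (hρ s (W₁ *ᵥ z))
    simp only [mulVec_sub, mulVec_smul, dotProduct_sub, dotProduct_smul, smul_eq_mul] at h2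
    rw [hα z hz] at h1
    simp only [sub_dotProduct, ← dotProduct_mulVec]
    refine (mul_eq_zero.1 (?_ : s * _ = 0)).resolve_left hs
    linarith
  have hαS : ∀ u, α ⬝ᵥ (S *ᵥ u) = β ⬝ᵥ (S *ᵥ (M *ᵥ u)) := by
    intro u
    rw [dotProduct_mulVec, dotProduct_mulVec, dotProduct_mulVec, ← sub_eq_zero, ← sub_dotProduct,
      ← neg_sub, ha, neg_zero, zero_dotProduct]
  -- Split y = (y - S W₂ y) + S W₂ y. On each summand of y₁ the form α agrees with β S W₁, and on y₂
  -- the form β agrees with β S W₂, so the total is β S (W₁ y₁ + W₂ y₂) = 0.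
  have hk : ∀ y, W₂ *ᵥ (y - S *ᵥ (W₂ *ᵥ y)) = 0 := fun y => by
    rw [mulVec_sub, mulVec_mulVec, hS, one_mulVec, sub_self]
  have e1 := hα _ (hk y₁)
  have e2 := hβ _ (hk y₂)
  have e3 := hαS (W₂ *ᵥ y₁)
  have e4 : W₂ *ᵥ y₂ = -(W₁ *ᵥ y₁) := by rw [eq_neg_iff_add_eq_zero, add_comm, hy]
  have e5 : W₁ *ᵥ (S *ᵥ (W₂ *ᵥ y₁)) = M *ᵥ (W₂ *ᵥ y₁) := by rw [mulVec_mulVec]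
  rw [e4] at e2
  simp only [dotProduct_sub, mulVec_sub, mulVec_neg, dotProduct_neg, e5] at e1 e2
  linarith

/-- The kernel of `W = [W₁ | W₂]` is spanned by the unfoldings `(c₀ x, c₁ x)` of rank-1 matrices
that it contains. -/
def KernelSpannedByOuter {n d : Type*} [Fintype n] (W : Matrix d (n ⊕ n) ℝ) : Prop :=
  ∀ y, W *ᵥ y = 0 → y ∈ Submodule.span ℝ
    {v | W *ᵥ v = 0 ∧ ∃ (x : n → ℝ) (c : Fin 2 → ℝ), v = Sum.elim (c 0 • x) (c 1 • x)}

/-- By duality: a kernel vector outside the span would be detected by a linear form (α, β) vanishing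
on the span, in particular on all its vectors (s x, x). -/
theorem kernelSpannedByOuter_of_controllable {n d : Type*} [Fintype n] [Fintype d]
    [DecidableEq n] [DecidableEq d] (W₁ W₂ : Matrix d n ℝ) (S : Matrix n d ℝ) (z : n → ℝ)
    (hS : W₂ * S = 1) (hz : W₂ *ᵥ z = 0)
    (hctrl : ∀ a : d → ℝ, (∀ k : ℕ, a ⬝ᵥ ((W₁ * S) ^ k *ᵥ (W₁ *ᵥ z)) = 0) → a = 0) :
    KernelSpannedByOuter (fromCols W₁ W₂) := by
  intro y hy
  by_contra hmem
  obtain ⟨f, hfy, hf⟩ := Submodule.exists_le_ker_of_notMem hmem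
  have hrep : ∀ v, f v = (fun i => f (Pi.single i 1)) ⬝ᵥ v := by
    intro v
    conv_lhs => rw [pi_eq_sum_univ' v]
    simp [dotProduct, mul_comm]
  have hsum : ∀ a b : n → ℝ, f (Sum.elim a b) =
      (fun j => f (Pi.single (Sum.inl j) 1)) ⬝ᵥ a + (fun j => f (Pi.single (Sum.inr j) 1)) ⬝ᵥ b := by
    intro a b
    rw [hrep, dotProduct, Fintype.sum_sum_type]
    rfl
  apply hfy
  rw [← Sum.elim_comp_inl_inr y, hsum]
  refine dotProduct_add_eq_zero_of_controllable W₁ W₂ S z hS hz hctrl _ _ ?_ _ _ ?_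
  · intro s x hx
    have : f (Sum.elim (s • x) x) = 0 := by
      refine hf (Submodule.subset_span ⟨?_, x, ![s, 1], by simp⟩)
      rw [fromCols_mulVec]
      simpa [add_mulVec, smul_mulVec, mulVec_smul] using hx
    rw [hsum] at this
    simpa using this
  · rw [fromCols_mulVec] at hy
    exact hy

/-! ### A polynomial certificate of controllability -/

section Pencil

variable {n : Type*} {d : ℕ}

/-- The vector that, together with `pencilMatrix`, generates the Krylov space. -/
noncomputable def pencilVector (ι : Fin d → n) (j : n) (W : Matrix (Fin d) (n ⊕ n) ℝ) :
    Fin d → ℝ :=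
  (W.submatrix id (Sum.inr ∘ ι)).det • W.col (Sum.inl j) -
    W.submatrix id (Sum.inl ∘ ι) *ᵥ
      ((W.submatrix id (Sum.inr ∘ ι)).adjugate *ᵥ W.col (Sum.inr j))

/-- The adjugate replaces the inverse to keep the entries polynomial, so this is a determinant times
the matrix W₁S of the controllability criterion. -/
noncomputable def pencilMatrix (ι : Fin d → n) (W : Matrix (Fin d) (n ⊕ n) ℝ) :
    Matrix (Fin d) (Fin d) ℝ :=
  W.submatrix id (Sum.inl ∘ ι) * (W.submatrix id (Sum.inr ∘ ι)).adjugate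

noncomputable def krylovMatrix (M : Matrix (Fin d) (Fin d) ℝ) (w : Fin d → ℝ) :
    Matrix (Fin d) (Fin d) ℝ :=
  Matrix.of fun i k => (M ^ (k : ℕ) *ᵥ w) i

/-- A polynomial in the entries of the pencil `W` whose nonvanishing implies that the kernel of
`W` is spanned by rank-1 matrices. -/
noncomputable def pencilInvariant (ι : Fin d → n) (j : n) (W : Matrix (Fin d) (n ⊕ n) ℝ) : ℝ :=
  (W.submatrix id (Sum.inr ∘ ι)).det * (krylovMatrix (pencilMatrix ι W) (pencilVector ι j W)).det

theorem PolynomialOnLines.pencilInvariant {E : Type*} [AddCommGroup E] [Module ℝ E]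
    [TopologicalSpace E] {W : E → Matrix (Fin d) (n ⊕ n) ℝ}
    (hW : ∀ i c, PolynomialOnLines (fun x => W x i c)) (ι : Fin d → n) (j : n) :
    PolynomialOnLines (fun x => pencilInvariant ι j (W x)) := by
  have hadj : ∀ a b, PolynomialOnLines
      fun x => ((W x).submatrix id (Sum.inr ∘ ι)).adjugate a b :=
    adjugate fun a b => hW _ _
  refine (det fun a b => hW _ _).mul (det fun a b => ?_)
  refine pow_mulVec (A := fun x => pencilMatrix ι (W x)) (fun a b => ?_) (fun a => ?_) b a
  · exact matrix_mul (fun a b => hW _ _) hadj a b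
  · exact ((det fun a b => hW _ _).mul (hW _ _)).sub
      (mulVec (A := fun x => (W x).submatrix id (Sum.inl ∘ ι)) (fun a b => hW _ _)
        (mulVec hadj fun a => hW _ _) a)

theorem kernelSpannedByOuter_of_pencilInvariant_ne_zero [Fintype n] [DecidableEq n]
    (ι : Fin d → n) (j : n) (W : Matrix (Fin d) (n ⊕ n) ℝ) (h : pencilInvariant ι j W ≠ 0) :
    KernelSpannedByOuter W := by
  obtain ⟨hdet, hkry⟩ := mul_ne_zero_iff.1 h
  set δ := (W.submatrix id (Sum.inr ∘ ι)).det with hδ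
  set K := (W.submatrix id (Sum.inr ∘ ι)).adjugate with hK
  have hE : ∀ A : Matrix (Fin d) n ℝ, A * (1 : Matrix n n ℝ).submatrix id ι = A.submatrix id ι := by
    intro A
    ext a b
    simp [Matrix.mul_apply, Matrix.one_apply]
  have hW : W = fromCols W.toCols₁ W.toCols₂ := (fromCols_toCols W).symm
  have hM1 : W.toCols₁.submatrix id ι = W.submatrix id (Sum.inl ∘ ι) := rfl
  have hM2 : W.toCols₂.submatrix id ι = W.submatrix id (Sum.inr ∘ ι) := rfl
  rw [hW]
  -- `S` inverts `W₂` on the columns `ι`; the second vector is the kernel vector of `W₂` obtained by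
  -- eliminating column `j` against those columns.
  refine kernelSpannedByOuter_of_controllable _ _ (δ⁻¹ • ((1 : Matrix n n ℝ).submatrix id ι * K))
    (δ • Pi.single j 1 - (1 : Matrix n n ℝ).submatrix id ι *ᵥ (K *ᵥ W.col (Sum.inr j))) ?_ ?_ ?_
  · rw [Matrix.mul_smul, ← Matrix.mul_assoc, hE, hM2, hK, mul_adjugate, smul_smul, ← hδ,
      inv_mul_cancel₀ hdet, one_smul]
  · rw [mulVec_sub, mulVec_smul, mulVec_single_one, mulVec_mulVec, hE, hM2, mulVec_mulVec, hK,
      mul_adjugate, smul_mulVec, one_mulVec, ← hδ]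
    exact sub_self _
  · intro a ha
    have h1 : W.toCols₁ * (δ⁻¹ • ((1 : Matrix n n ℝ).submatrix id ι * K)) =
        δ⁻¹ • pencilMatrix ι W := by
      rw [Matrix.mul_smul, ← Matrix.mul_assoc, hE, hM1]; rfl
    have h2 : W.toCols₁ *ᵥ (δ • Pi.single j 1 -
        (1 : Matrix n n ℝ).submatrix id ι *ᵥ (K *ᵥ W.col (Sum.inr j))) = pencilVector ι j W := by
      rw [mulVec_sub, mulVec_smul, mulVec_single_one, mulVec_mulVec, hE, hM1]; rfl
    rw [h1, h2] at ha
    refine eq_zero_of_vecMul_eq_zero hkry ?_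
    ext k
    have h3 := ha k
    rw [smul_pow, smul_mulVec, dotProduct_smul, smul_eq_mul] at h3
    exact (mul_eq_zero.1 h3).resolve_left (pow_ne_zero _ (inv_ne_zero hdet))

/-- Row operations preserve controllability: the Krylov vectors are multiplied by `g`, up to powers
of `g.det` produced by the adjugates. -/
theorem pencilInvariant_mul_ne_zero (ι : Fin d → n) (j : n) (W : Matrix (Fin d) (n ⊕ n) ℝ)
    (g : Matrix (Fin d) (Fin d) ℝ) (hg : g.det ≠ 0) (h : pencilInvariant ι j W ≠ 0) :
    pencilInvariant ι j (g * W) ≠ 0 := by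
  obtain ⟨hdet, hkry⟩ := mul_ne_zero_iff.1 h
  have hsub : ∀ f : Fin d → n ⊕ n, (g * W).submatrix id f = g * W.submatrix id f := fun f => rfl
  have hcol : ∀ c, (g * W).col c = g *ᵥ W.col c := fun c => rfl
  have hw : pencilVector ι j (g * W) = g.det • (g *ᵥ pencilVector ι j W) := by
    simp only [pencilVector, hsub, hcol, adjugate_mul_distrib, det_mul, mulVec_sub, mulVec_smul,
      smul_sub]
    congr 1
    · rw [smul_smul]
    · simp only [mulVec_mulVec, Matrix.mul_assoc]
      rw [adjugate_mul]
      simp [smul_mulVec]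
  have hM : pencilMatrix ι (g * W) = g * (pencilMatrix ι W * g.adjugate) := by
    simp only [pencilMatrix, hsub, adjugate_mul_distrib, Matrix.mul_assoc]
  have hpow : ∀ k : ℕ, pencilMatrix ι (g * W) ^ k *ᵥ pencilVector ι j (g * W) =
      g.det ^ (k + 1) • (g *ᵥ (pencilMatrix ι W ^ k *ᵥ pencilVector ι j W)) := by
    intro k
    induction k with
    | zero => simp [hw]
    | succ k ih =>
      rw [pow_succ', ← mulVec_mulVec, ih, hM, mulVec_smul, ← mulVec_mulVec, ← mulVec_mulVec,
        mulVec_mulVec _ g.adjugate, adjugate_mul, smul_mulVec, one_mulVec, mulVec_smul,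
        mulVec_smul, smul_smul, mulVec_mulVec _ (pencilMatrix ι W), ← pow_succ', ← pow_succ]
  have hkr : krylovMatrix (pencilMatrix ι (g * W)) (pencilVector ι j (g * W)) =
      g * krylovMatrix (pencilMatrix ι W) (pencilVector ι j W) *
        diagonal fun k : Fin d => g.det ^ ((k : ℕ) + 1) := by
    ext i k
    rw [mul_diagonal]
    simp only [krylovMatrix, of_apply, hpow, Pi.smul_apply, smul_eq_mul]
    rw [mul_comm]
    rfl
  rw [pencilInvariant, hkr, hsub]
  simp only [det_mul, det_diagonal]
  refine mul_ne_zero (mul_ne_zero hg hdet) (mul_ne_zero (mul_ne_zero hg hkry) ?_)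
  exact Finset.prod_ne_zero_iff.2 fun k _ => pow_ne_zero _ hg

theorem exists_pencilInvariant_ne_zero (ι : Fin d → n) (hι : Function.Injective ι) (j : n)
    (hj : ∀ i, ι i ≠ j) : ∃ W : Matrix (Fin d) (n ⊕ n) ℝ, pencilInvariant ι j W ≠ 0 := by
  classical
  -- A diagonal pencil with distinct eigenvalues 0, ..., d - 1 and the all-ones vector, whose Krylov
  -- matrix is Vandermonde.
  let W : Matrix (Fin d) (n ⊕ n) ℝ := Matrix.of fun i c =>
    Sum.elim (fun a => if a = ι i then (i : ℝ) else if a = j then 1 else 0)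
      (fun a => if a = ι i then 1 else 0) c
  have h2 : W.submatrix id (Sum.inr ∘ ι) = 1 := by
    ext a b
    simp [W, Matrix.one_apply, hι.eq_iff, eq_comm]
  have h1 : W.submatrix id (Sum.inl ∘ ι) = diagonal fun i : Fin d => (i : ℝ) := by
    ext a b
    by_cases h : a = b
    · simp [W, h]
    · simp [W, hι.eq_iff, hj, h, Ne.symm h]
  have h3 : W.col (Sum.inr j) = 0 := by
    ext a
    simp [W, (hj a).symm]
  have h4 : W.col (Sum.inl j) = fun _ => 1 := by
    ext a
    simp [W, (hj a).symm]
  refine ⟨W, ?_⟩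
  have hk : krylovMatrix (pencilMatrix ι W) (pencilVector ι j W) =
      vandermonde fun i : Fin d => (i : ℝ) := by
    ext a b
    simp [krylovMatrix, pencilMatrix, pencilVector, h1, h2, h3, h4, diagonal_pow,
      mulVec_diagonal, vandermonde_apply]
  rw [pencilInvariant, hk, h2, det_one, one_mul, det_vandermonde_ne_zero_iff]
  intro a b hab
  exact Fin.ext (Nat.cast_injective (R := ℝ) hab)

/-- The matrix `[-Cᵀ | 1]`, with columns rearranged by `e`. -/
def chartMatrix {ρ : Type*} (e : ρ ⊕ Fin d ≃ n ⊕ n) (C : Matrix ρ (Fin d) ℝ) :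
    Matrix (Fin d) (n ⊕ n) ℝ :=
  (fromCols (-Cᵀ) (1 : Matrix (Fin d) (Fin d) ℝ)).submatrix id e.symm

theorem exists_chartMatrix_pencilInvariant_ne_zero {ρ : Type*} (e : ρ ⊕ Fin d ≃ n ⊕ n)
    (ι : Fin d → n) (hι : Function.Injective ι) (j : n) (hj : ∀ i, ι i ≠ j) :
    ∃ C : Matrix ρ (Fin d) ℝ, pencilInvariant ι j (chartMatrix e C) ≠ 0 := by
  have happ : ∀ i c, PolynomialOnLines fun W : Matrix (Fin d) (n ⊕ n) ℝ => W i c := by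
    refine fun i c => ⟨by fun_prop, fun x y =>
      ⟨Polynomial.C (x i c) + Polynomial.X * Polynomial.C (y i c), fun t => by simp; ring⟩⟩
  obtain ⟨W₀, h₀⟩ := exists_pencilInvariant_ne_zero ι hι j hj
  have h1 : ((chartMatrix e (0 : Matrix ρ (Fin d) ℝ)).submatrix id (e ∘ Sum.inr)).det ≠ 0 := by
    have : (chartMatrix e (0 : Matrix ρ (Fin d) ℝ)).submatrix id (e ∘ Sum.inr) = 1 := by
      ext a b
      simp [chartMatrix]
    simp [this]
  -- A pencil that is both controllable and invertible on the last `d` columns of the chart;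
  -- multiplying by the inverse of that block brings it to the form [-Cᵀ | 1].
  obtain ⟨W, hW, hg⟩ := PolynomialOnLines.exists_ne_zero
    (PolynomialOnLines.pencilInvariant happ ι j)
    (PolynomialOnLines.det (A := fun W : Matrix (Fin d) (n ⊕ n) ℝ =>
      W.submatrix id (e ∘ Sum.inr)) fun a b => happ _ _) h₀ h1
  set g := W.submatrix id (e ∘ Sum.inr) with hgdef
  refine ⟨-(g⁻¹ * W.submatrix id (e ∘ Sum.inl))ᵀ, ?_⟩
  have : chartMatrix e (-(g⁻¹ * W.submatrix id (e ∘ Sum.inl))ᵀ) = g⁻¹ * W := by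
    ext i c
    obtain ⟨c, rfl⟩ := e.surjective c
    rcases c with c | c
    · simp [chartMatrix, Matrix.mul_apply]
    · have := congrFun (congrFun (nonsing_inv_mul g (isUnit_iff_ne_zero.2 hg)) i) c
      rw [Matrix.mul_apply] at this
      simp only [chartMatrix, submatrix_apply, Equiv.symm_apply_apply, fromCols_apply_inr, id]
      rw [← this, Matrix.mul_apply]
      rfl
  rw [this]
  refine pencilInvariant_mul_ne_zero ι j W _ ?_ hW
  exact (isUnit_iff_ne_zero.1 ((isUnit_nonsing_inv_det_iff).2 (isUnit_iff_ne_zero.2 hg)))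

end Pencil

/-! ### Charts and normal spaces of the matrices of rank R -/

namespace Matrix

theorem rank_add_le_add {m n : Type*} [Fintype m] [Fintype n] (A B : Matrix m n ℝ) :
    (A + B).rank ≤ A.rank + B.rank := by
  rw [rank, rank, rank, mulVecLin_add]
  refine (Submodule.finrank_mono (LinearMap.range_add_le _ _)).trans ?_
  exact Submodule.finrank_add_le_finrank_add_finrank _ _

/-- All rows of a matrix of rank `R` are combinations of `R` of its rows. -/
theorem exists_rows_eq_mul {m n : Type*} [Fintype m] [Fintype n] (X : Matrix m n ℝ) {R p : ℕ}
    (hX : X.rank = R) (hm : Fintype.card m = R + p) :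
    ∃ (f : Fin R ⊕ Fin p ≃ m) (E : Matrix (Fin p) (Fin R) ℝ),
      X.submatrix (f ∘ Sum.inr) id = E * X.submatrix (f ∘ Sum.inl) id := by
  classical
  obtain ⟨κ, a, ha, hspan, hli⟩ := exists_linearIndependent' ℝ X.row
  have : Fintype κ := Fintype.ofInjective a ha
  have hκ : Fintype.card κ = R := by
    rw [← hX, rank_eq_finrank_span_row, ← hspan, finrank_span_eq_card hli]
  let eκ : Fin R ≃ κ := (Fintype.equivFinOfCardEq hκ).symm
  let g : Fin R ≃ {i // i ∈ Set.range a} := eκ.trans (Equiv.ofInjective a ha)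
  have hc : Fintype.card {i // ¬ i ∈ Set.range a} = p := by
    rw [Fintype.card_subtype_compl, ← Fintype.card_congr g, Fintype.card_fin, hm]
    omega
  let h : Fin p ≃ {i // ¬ i ∈ Set.range a} := (Fintype.equivFinOfCardEq hc).symm
  let f : Fin R ⊕ Fin p ≃ m := (Equiv.sumCongr g h).trans (Equiv.sumCompl _)
  have hrow : ∀ i, ∃ c : Fin R → ℝ, ∑ k, c k • X.row (a (eκ k)) = X.row i := by
    intro i
    have : X.row i ∈ Submodule.span ℝ (Set.range (X.row ∘ a)) := by
      rw [hspan]; exact Submodule.subset_span ⟨i, rfl⟩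
    obtain ⟨c, hc⟩ := (Submodule.mem_span_range_iff_exists_fun ℝ).1 this
    exact ⟨fun k => c (eκ k), by rw [← hc, ← Equiv.sum_comp eκ]; rfl⟩
  choose c hc using hrow
  refine ⟨f, Matrix.of fun i k => c (f (Sum.inr i)) k, ?_⟩
  ext i j
  have := congrFun (hc (f (Sum.inr i))) j
  rw [Finset.sum_apply] at this
  rw [submatrix_apply, Matrix.mul_apply]
  exact this.symm

/-- Choose R independent rows, then R independent columns of the resulting submatrix; `E` and `C`
express the other rows and columns through them. -/
theorem exists_chart {m n : Type*} [Fintype m] [Fintype n] (X : Matrix m n ℝ) {R p d : ℕ}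
    (hX : X.rank = R) (hm : Fintype.card m = R + p) (hn : Fintype.card n = R + d) :
    ∃ (f : Fin R ⊕ Fin p ≃ m) (e : Fin R ⊕ Fin d ≃ n) (A : Matrix (Fin R) (Fin R) ℝ)
      (C : Matrix (Fin R) (Fin d) ℝ) (E : Matrix (Fin p) (Fin R) ℝ), A.det ≠ 0 ∧
      X.submatrix f e = fromBlocks A (A * C) (E * A) (E * A * C) := by
  classical
  obtain ⟨f, E, hE⟩ := exists_rows_eq_mul X hX hm
  set Y := X.submatrix (f ∘ Sum.inl) id with hY
  have hXY : X.submatrix f id = fromRows 1 E * Y := by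
    rw [fromRows_mul, Matrix.one_mul, ← hE]
    ext (i | i) j <;> rfl
  have hYR : Y.rank = R := by
    refine le_antisymm (by simpa using Y.rank_le_card_height) ?_
    calc R = (X.submatrix f (Equiv.refl n)).rank := by rw [rank_submatrix, hX]
      _ = (fromRows 1 E * Y).rank := by rw [← hXY]; rfl
      _ ≤ Y.rank := rank_mul_le_right _ _
  obtain ⟨e, C, hC⟩ := exists_rows_eq_mul Yᵀ (by rw [rank_transpose, hYR]) hn
  set A := Y.submatrix id (e ∘ Sum.inl) with hA
  have hYA : Y.submatrix id e = A * fromCols 1 Cᵀ := by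
    rw [mul_fromCols, Matrix.mul_one]
    have h1 : Y.submatrix id (e ∘ Sum.inr) = A * Cᵀ := by
      have := congrArg transpose hC
      rwa [transpose_mul] at this
    rw [← h1]
    ext i (j | j) <;> rfl
  have hAR : A.rank = R := by
    refine le_antisymm (by simpa using A.rank_le_card_height) ?_
    calc R = (Y.submatrix (Equiv.refl _) e).rank := by rw [rank_submatrix, hYR]
      _ = (A * fromCols 1 Cᵀ).rank := by rw [← hYA]; rfl
      _ ≤ A.rank := rank_mul_le_left _ _
  refine ⟨f, e, A, Cᵀ, E, ?_, ?_⟩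
  · rw [← isUnit_iff_ne_zero, ← isUnit_iff_isUnit_det, ← mulVec_surjective_iff_isUnit]
    have : LinearMap.range A.mulVecLin = ⊤ :=
      Submodule.eq_top_of_finrank_eq (by rw [← rank, hAR]; simp)
    exact LinearMap.range_eq_top.1 this
  · have : X.submatrix f e = fromRows 1 E * (A * fromCols 1 Cᵀ) := by
      rw [← hYA]
      have := congrArg (fun M => M.submatrix id e) hXY
      exact this
    rw [this, mul_fromCols, fromRows_mul, Matrix.one_mul, Matrix.mul_one, mul_fromCols,
      ← Matrix.mul_assoc]
    ext (i | i) (j | j) <;> rfl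

/-- Cancelling the invertible `A` from the block equations determines three blocks of `U` from the
fourth. -/
theorem normal_eq_fromBlocks {R p d : ℕ} {A : Matrix (Fin R) (Fin R) ℝ} (hA : A.det ≠ 0)
    (C : Matrix (Fin R) (Fin d) ℝ) (E : Matrix (Fin p) (Fin R) ℝ)
    (U : Matrix (Fin R ⊕ Fin p) (Fin R ⊕ Fin d) ℝ)
    (h1 : U * (fromBlocks A (A * C) (E * A) (E * A * C))ᵀ = 0)
    (h2 : (fromBlocks A (A * C) (E * A) (E * A * C))ᵀ * U = 0) :
    ∃ D : Matrix (Fin p) (Fin d) ℝ,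
      U = fromBlocks (Eᵀ * D * Cᵀ) (-(Eᵀ * D)) (-(D * Cᵀ)) D := by
  have hu : IsUnit Aᵀ.det := by
    rw [det_transpose]
    exact isUnit_iff_ne_zero.2 hA
  rw [← fromBlocks_toBlocks U, fromBlocks_transpose, fromBlocks_multiply, ← fromBlocks_zero,
    fromBlocks_inj] at h1 h2
  have cancel_left : ∀ {k : ℕ} (M : Matrix (Fin R) (Fin k) ℝ), Aᵀ * M = 0 → M = 0 := by
    intro k M hM
    rw [← nonsing_inv_mul_cancel_left _ M hu, hM, Matrix.mul_zero]
  have cancel_right : ∀ {k : ℕ} (M : Matrix (Fin k) (Fin R) ℝ), M * Aᵀ = 0 → M = 0 := by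
    intro k M hM
    rw [← mul_nonsing_inv_cancel_right _ M hu, hM, Matrix.zero_mul]
  have e1 : U.toBlocks₁₁ + U.toBlocks₁₂ * Cᵀ = 0 := cancel_right _ <| by
    rw [Matrix.add_mul, Matrix.mul_assoc, ← transpose_mul]; exact h1.1
  have e2 : U.toBlocks₂₁ + U.toBlocks₂₂ * Cᵀ = 0 := cancel_right _ <| by
    rw [Matrix.add_mul, Matrix.mul_assoc, ← transpose_mul]; exact h1.2.2.1
  have e3 : U.toBlocks₁₂ + Eᵀ * U.toBlocks₂₂ = 0 := cancel_left _ <| by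
    rw [Matrix.mul_add, ← Matrix.mul_assoc, ← transpose_mul]; exact h2.2.1
  refine ⟨U.toBlocks₂₂, ?_⟩
  have e3' := eq_neg_of_add_eq_zero_left e3
  conv_lhs => rw [← fromBlocks_toBlocks U]
  rw [eq_neg_of_add_eq_zero_left e1, eq_neg_of_add_eq_zero_left e2, e3', Matrix.neg_mul, neg_neg]

end Matrix

/-! ### Tensor rank and the row space of the unfolding -/

namespace ThreeWayArray

variable {I J : ℕ}

theorem rank_sum_outer_le {K : ℕ} {κ : Type*} [Fintype κ] (a : κ → Fin I → ℝ)
    (b : κ → Fin J → ℝ) (c : κ → Fin K → ℝ) :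
    (∑ k, outer (a k) (b k) (c k)).rank ≤ Fintype.card κ := by
  classical
  -- Zero terms are not rank-1 arrays and must be dropped.
  let s : Finset κ := Finset.univ.filter fun k => outer (a k) (b k) (c k) ≠ 0
  have hs : ∑ k, outer (a k) (b k) (c k) = ∑ k ∈ s, outer (a k) (b k) (c k) := by
    rw [Finset.sum_filter_ne_zero]
  refine ((isLeast_rank _).2 ⟨fun r => outer (a (s.equivFin.symm r)) (b (s.equivFin.symm r))
    (c (s.equivFin.symm r)), fun r => ?_, ?_⟩).trans (s.card_le_univ)
  · have h := (Finset.mem_filter.1 (s.equivFin.symm r).2).2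
    refine ⟨_, _, _, ?_, ?_, ?_, rfl⟩ <;>
    · intro h0
      refine h ?_
      funext q
      simp [outer, h0]
  · rw [hs, Equiv.sum_comp s.equivFin.symm (fun q : s => outer (a q) (b q) (c q)),
      Finset.sum_coe_sort s (fun q => outer (a q) (b q) (c q))]

/-- A sum of r rank-1 arrays factors the unfolding through ℝʳ. -/
theorem rank_unfolding_le_rank (Y : ThreeWayArray I J 2) : Y.unfolding.rank ≤ Y.rank := by
  obtain ⟨T, hT, hY⟩ := (isLeast_rank Y).1
  choose a b c _ _ _ hT using hT
  have : Y.unfolding = (Matrix.of fun i r => a r i) *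
      (Matrix.of fun r => Sum.elim (c r 0 • b r) (c r 1 • b r)) := by
    ext i (j | j)
    · conv_lhs => rw [hY]
      simp [unfolding, slice, Matrix.mul_apply, hT, outer]
      exact Finset.sum_congr rfl fun r _ => by ring
    · conv_lhs => rw [hY]
      simp [unfolding, slice, Matrix.mul_apply, hT, outer]
      exact Finset.sum_congr rfl fun r _ => by ring
  rw [this]
  exact (rank_mul_le_left _ _).trans 
    (by simpa using rank_le_card_width (Matrix.of fun i r => a r i))

/-- Extract a basis of rank-1 matrices; expanding every row of the unfolding in it writes `Y` with
one outer product per basis element. -/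
theorem rank_le_finrank_ker {d : Type*} [Fintype d] (Y : ThreeWayArray I J 2)
    (W : Matrix d (Fin J ⊕ Fin J) ℝ) (hW : KernelSpannedByOuter W)
    (hY : ∀ i, W *ᵥ Y.unfolding i = 0) :
    Y.rank ≤ Module.finrank ℝ (LinearMap.ker W.mulVecLin) := by
  set s := {v | W *ᵥ v = 0 ∧
    ∃ (x : Fin J → ℝ) (c : Fin 2 → ℝ), v = Sum.elim (c 0 • x) (c 1 • x)} with hs
  obtain ⟨b, hb, hspan, hli⟩ := exists_linearIndependent ℝ s
  have hfin : b.Finite := hli.setFinite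
  have : Fintype b := hfin.fintype
  have hcard : Fintype.card b ≤ Module.finrank ℝ (LinearMap.ker W.mulVecLin) := by
    rw [← finrank_span_eq_card hli]
    refine Submodule.finrank_mono (Submodule.span_le.2 ?_)
    rintro _ ⟨v, rfl⟩
    exact (hb v.2).1
  have hrow : ∀ i, ∃ a : b → ℝ, ∑ v, a v • (v : Fin J ⊕ Fin J → ℝ) = Y.unfolding i := by
    intro i
    refine (Submodule.mem_span_range_iff_exists_fun ℝ).1 ?_
    rw [Subtype.range_coe, hspan]
    exact hW _ (hY i)
  choose a ha using hrow
  choose x c hx using fun v : b => (hb v.2).2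
  have hsum : Y = ∑ v : b, outer (fun i => a i v) (x v) (c v) := by
    funext ⟨i, j, k⟩
    rw [Finset.sum_apply]
    fin_cases k
    · have := congrFun (ha i) (Sum.inl j)
      rw [Finset.sum_apply] at this
      refine this.symm.trans (Finset.sum_congr rfl fun v _ => ?_)
      rw [Pi.smul_apply, hx v]
      simp [outer]; ring
    · have := congrFun (ha i) (Sum.inr j)
      rw [Finset.sum_apply] at this
      refine this.symm.trans (Finset.sum_congr rfl fun v _ => ?_)
      rw [Pi.smul_apply, hx v]
      simp [outer]; ring
  rw [hsum]
  exact (rank_sum_outer_le _ _ _).trans hcard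

theorem rank_le_of_chart {R p d : ℕ} (Y : ThreeWayArray I J 2) (f : Fin R ⊕ Fin p ≃ Fin I)
    (e : Fin R ⊕ Fin d ≃ Fin J ⊕ Fin J) (A : Matrix (Fin R) (Fin R) ℝ)
    (C : Matrix (Fin R) (Fin d) ℝ) (E : Matrix (Fin p) (Fin R) ℝ)
    (hY : Y.unfolding.submatrix f e = fromBlocks A (A * C) (E * A) (E * A * C))
    (hC : KernelSpannedByOuter (chartMatrix e C)) : Y.rank ≤ R := by
  have hmul : ∀ v, chartMatrix e C *ᵥ v =
      -Cᵀ *ᵥ (v ∘ e ∘ Sum.inl) + v ∘ e ∘ Sum.inr := by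
    intro v
    rw [chartMatrix, submatrix_mulVec_equiv, fromCols_mulVec, one_mulVec]
    rfl
  refine (rank_le_finrank_ker Y _ hC fun i => ?_).trans ?_
  · obtain ⟨i, rfl⟩ := f.surjective i
    have h1 : ∀ c, Y.unfolding (f i) (e c) =
        fromBlocks A (A * C) (E * A) (E * A * C) i c := fun c => congrFun (congrFun hY i) c
    rw [hmul]
    ext k
    rcases i with i | i <;>
      simp [mulVec, dotProduct, h1, Matrix.mul_apply, Matrix.neg_apply, mul_comm]
  -- A kernel vector of [-Cᵀ | 1] is determined by its first R chart coordinates.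
  · let g : LinearMap.ker (chartMatrix e C).mulVecLin →ₗ[ℝ] (Fin R → ℝ) :=
      (LinearMap.funLeft ℝ ℝ (e ∘ Sum.inl)).comp (Submodule.subtype _)
    have hg : Function.Injective g := by
      rw [← LinearMap.ker_eq_bot, LinearMap.ker_eq_bot']
      rintro ⟨v, hv⟩ h0
      have h1 : v ∘ e ∘ Sum.inl = 0 := h0
      have h2 : chartMatrix e C *ᵥ v = 0 := hv
      rw [hmul, h1, mulVec_zero, zero_add] at h2
      ext c
      obtain ⟨c, rfl⟩ := e.surjective c
      rcases c with c | c
      · exact congrFun h1 c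
      · exact congrFun h2 c
    simpa using LinearMap.finrank_le_finrank_of_injective hg

end ThreeWayArray

/-! ### Distance to `W I J R` and uniqueness of the nearest point -/

theorem Matrix.isClosed_setOf_rank_le {m n : Type*} [Fintype m] [Fintype n] (R : ℕ) :
    IsClosed {A : Matrix m n ℝ | A.rank ≤ R} := by
  rw [← isOpen_compl_iff, isOpen_iff_mem_nhds]
  intro A hA
  obtain ⟨κ, a, ha, hspan, hli⟩ := exists_linearIndependent' ℝ A.row
  have : Fintype κ := Fintype.ofInjective a ha
  have hκ : Fintype.card κ = A.rank := by
    rw [rank_eq_finrank_span_row, ← hspan, finrank_span_eq_card hli]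
  -- Independence of a fixed family of rows is an open condition, so the rank cannot drop nearby.
  have hopen : IsOpen {B : Matrix m n ℝ | LinearIndependent ℝ fun k => B.row (a k)} := by
    refine (isOpen_setOfPred_linearIndependent (𝕜 := ℝ) (E := n → ℝ) (ι := κ)).preimage
      (f := fun (B : Matrix m n ℝ) k => B.row (a k)) ?_
    exact continuous_pi fun k => continuous_apply (a k)
  refine Filter.mem_of_superset (hopen.mem_nhds hli) fun B hB => ?_
  have h1 : (B.submatrix a (Equiv.refl n)).rank = Fintype.card κ :=
    LinearIndependent.rank_matrix hB
  have h2 := rank_submatrix_le B a (Equiv.refl n)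
  simp only [Set.mem_compl_iff, Set.mem_ofPred_eq, not_le] at hA ⊢
  omega

namespace ThreeWayArray

variable {I J K : ℕ}

/-- The array with a given unfolding. -/
def ofUnfolding (M : Matrix (Fin I) (Fin J ⊕ Fin J) ℝ) : ThreeWayArray I J 2 :=
  fun q => M q.1 (if q.2.2 = 0 then Sum.inl q.2.1 else Sum.inr q.2.1)

@[simp]
theorem unfolding_ofUnfolding (M : Matrix (Fin I) (Fin J ⊕ Fin J) ℝ) :
    (ofUnfolding M).unfolding = M := by
  ext i (j | j) <;> simp [unfolding, slice, ofUnfolding]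

theorem ofUnfolding_unfolding (Y : ThreeWayArray I J 2) : ofUnfolding Y.unfolding = Y := by
  funext ⟨i, j, k⟩
  fin_cases k <;> simp [unfolding, slice, ofUnfolding]

theorem unfolding_add (X Y : ThreeWayArray I J 2) :
    (X + Y).unfolding = X.unfolding + Y.unfolding := by
  ext i (j | j) <;> rfl

theorem unfolding_sub (X Y : ThreeWayArray I J 2) :
    (X - Y).unfolding = X.unfolding - Y.unfolding := by
  ext i (j | j) <;> rfl

theorem unfolding_smul (s : ℝ) (X : ThreeWayArray I J 2) :
    (s • X).unfolding = s • X.unfolding := by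
  ext i (j | j) <;> rfl

theorem continuous_unfolding : Continuous (unfolding : ThreeWayArray I J 2 → _) := by
  refine continuous_matrix fun i c => ?_
  rcases c with j | j <;> exact continuous_apply _

theorem dotProduct_ofUnfolding (U : ThreeWayArray I J 2) (M : Matrix (Fin I) (Fin J ⊕ Fin J) ℝ) :
    U ⬝ᵥ ofUnfolding M = ∑ i, ∑ c, U.unfolding i c * M i c := by
  simp only [dotProduct, Fintype.sum_prod_type, Fin.sum_univ_two, Fintype.sum_sum_type,
    Finset.sum_add_distrib]
  rfl

theorem frobeniusNorm_sq (Y : ThreeWayArray I J K) : frobeniusNorm Y ^ 2 = Y ⬝ᵥ Y := by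
  rw [frobeniusNorm, Real.sq_sqrt (Finset.sum_nonneg fun _ _ => sq_nonneg _), dotProduct]
  exact Finset.sum_congr rfl fun _ _ => sq _

theorem frobeniusNorm_nonneg (Y : ThreeWayArray I J K) : 0 ≤ frobeniusNorm Y := Real.sqrt_nonneg _

theorem norm_toLp (Y : ThreeWayArray I J K) : ‖WithLp.toLp 2 Y‖ = frobeniusNorm Y := by
  simp [EuclideanSpace.norm_eq, frobeniusNorm]

theorem isClosed_W (R : ℕ) : IsClosed (W I J R) :=
  (isClosed_setOf_rank_le R).preimage continuous_unfolding

theorem zero_mem_W (R : ℕ) : (0 : ThreeWayArray I J 2) ∈ W I J R := by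
  have : (0 : ThreeWayArray I J 2).unfolding = 0 := by
    ext i (j | j) <;> rfl
  simp [W, this]

/-- The distance to `W_R(I,J,2)` in the Frobenius norm. -/
noncomputable def distW (R : ℕ) (Z : ThreeWayArray I J 2) : ℝ :=
  Metric.infDist (WithLp.toLp 2 Z) (WithLp.ofLp ⁻¹' W I J R)

theorem distW_le {R : ℕ} {Y : ThreeWayArray I J 2} (hY : Y ∈ W I J R) (Z : ThreeWayArray I J 2) :
    distW R Z ≤ frobeniusNorm (Z - Y) := by
  have h : WithLp.toLp 2 Y ∈ WithLp.ofLp ⁻¹' W I J R := hY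
  refine (Metric.infDist_le_dist_of_mem h).trans (le_of_eq ?_)
  rw [dist_eq_norm, ← WithLp.toLp_sub, norm_toLp]

theorem exists_distW_eq (R : ℕ) (Z : ThreeWayArray I J 2) :
    ∃ X ∈ W I J R, distW R Z = frobeniusNorm (Z - X) := by
  have hcl : IsClosed (WithLp.ofLp ⁻¹' W I J R :
      Set (EuclideanSpace ℝ (Fin I × Fin J × Fin 2))) :=
    (isClosed_W R).preimage (PiLp.continuous_ofLp 2 _)
  obtain ⟨X, hX, h⟩ := hcl.exists_infDist_eq_dist ⟨0, zero_mem_W R⟩ (WithLp.toLp 2 Z)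
  refine ⟨X.ofLp, hX, ?_⟩
  rw [distW, h, dist_eq_norm, ← norm_toLp]
  rfl

theorem isOptimalSolution_iff {R : ℕ} {Z X : ThreeWayArray I J 2} :
    IsOptimalSolution R Z X ↔ X ∈ W I J R ∧ distW R Z = frobeniusNorm (Z - X) := by
  constructor
  · rintro ⟨hX, h⟩
    refine ⟨hX, le_antisymm (distW_le hX Z) ?_⟩
    obtain ⟨Y, hY, hd⟩ := exists_distW_eq R Z
    rw [hd]
    exact (sq_le_sq₀ (frobeniusNorm_nonneg _) (frobeniusNorm_nonneg _)).1 (h Y hY)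
  · rintro ⟨hX, h⟩
    refine ⟨hX, fun Y hY => ?_⟩
    have := distW_le hY Z
    rw [h] at this
    exact pow_le_pow_left₀ (frobeniusNorm_nonneg _) this 2

/-- The distance is Euclidean while the arrays carry the sup norm; changing norms only affects the
constant. -/
theorem exists_lipschitzWith_distW (R : ℕ) :
    ∃ C, LipschitzWith C (distW R : ThreeWayArray I J 2 → ℝ) :=
  ⟨_, (Metric.lipschitz_infDist_pt _).comp
    (PiLp.continuousLinearEquiv 2 ℝ fun _ : Fin I × Fin J × Fin 2 => ℝ).symm.lipschitz⟩

theorem frobeniusNorm_sq_add_smul (A H : ThreeWayArray I J K) (t : ℝ) :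
    frobeniusNorm (A + t • H) ^ 2 = A ⬝ᵥ A + 2 * t * (A ⬝ᵥ H) + t ^ 2 * (H ⬝ᵥ H) := by
  rw [frobeniusNorm_sq]
  simp only [add_dotProduct, dotProduct_add, smul_dotProduct, dotProduct_smul, smul_eq_mul,
    dotProduct_comm H A]
  ring

/-- Nearest points are unique where the distance function is differentiable. -/
theorem IsOptimalSolution.eq_of_differentiableAt {R : ℕ} {Z X X' : ThreeWayArray I J 2}
    (hd : DifferentiableAt ℝ (distW R) Z) (hX : IsOptimalSolution R Z X)
    (hX' : IsOptimalSolution R Z X') : X = X' := by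
  have key : ∀ Y, IsOptimalSolution R Z Y → ∀ H : ThreeWayArray I J 2,
      2 * ((Z - Y) ⬝ᵥ H) = deriv (fun t : ℝ => distW R (Z + t • H) ^ 2) 0 := by
    intro Y hY H
    obtain ⟨hYW, hdist⟩ := isOptimalSolution_iff.1 hY
    have h1 : DifferentiableAt ℝ (fun t : ℝ => distW R (Z + t • H) ^ 2) 0 := by
      refine DifferentiableAt.pow (DifferentiableAt.comp (g := distW R)
        (f := fun t : ℝ => Z + t • H) 0 (by simpa using hd) (by fun_prop)) 2
    have h2 : HasDerivAt (fun t : ℝ => frobeniusNorm (Z + t • H - Y) ^ 2)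
        (2 * ((Z - Y) ⬝ᵥ H)) 0 := by
      have : (fun t : ℝ => frobeniusNorm (Z + t • H - Y) ^ 2) = fun t =>
          (Z - Y) ⬝ᵥ (Z - Y) + 2 * t * ((Z - Y) ⬝ᵥ H) + t ^ 2 * (H ⬝ᵥ H) := by
        funext t
        rw [← frobeniusNorm_sq_add_smul, add_sub_right_comm]
      rw [this]
      have h3 := ((((hasDerivAt_id (0 : ℝ)).const_mul 2).mul_const ((Z - Y) ⬝ᵥ H)).const_add
        ((Z - Y) ⬝ᵥ (Z - Y))).add ((((hasDerivAt_id (0 : ℝ)).pow 2)).mul_const (H ⬝ᵥ H))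
      refine (h3.congr_deriv (by simp)).congr_of_eventuallyEq (Filter.Eventually.of_forall fun t => ?_)
      simp
    have h4 : IsLocalMin (fun t : ℝ => frobeniusNorm (Z + t • H - Y) ^ 2 -
        distW R (Z + t • H) ^ 2) 0 := by
      refine Filter.Eventually.of_forall fun t => ?_
      have h5 : distW R (Z + t • H) ^ 2 ≤ frobeniusNorm (Z + t • H - Y) ^ 2 :=
        pow_le_pow_left₀ Metric.infDist_nonneg (distW_le hYW _) 2
      simpa [hdist] using h5
    have := h4.hasDerivAt_eq_zero (h2.sub h1.hasDerivAt)
    linarith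
  have h := (key X hX (X' - X)).trans (key X' hX' (X' - X)).symm
  have h0 : (X' - X) ⬝ᵥ (X' - X) = 0 := by
    have : X' - X = (Z - X) - (Z - X') := by abel
    nth_rewrite 1 [this]
    rw [sub_dotProduct]
    linarith
  exact (sub_eq_zero.1 (dotProduct_self_eq_zero.1 h0)).symm

theorem ae_existsUnique_isOptimalSolution (I J R : ℕ) :
    ∀ᵐ Z : ThreeWayArray I J 2, ∃! X, IsOptimalSolution R Z X := by
  obtain ⟨C, hC⟩ := exists_lipschitzWith_distW (I := I) (J := J) R
  filter_upwards [hC.ae_differentiableAt] with Z hZ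
  obtain ⟨X, hX, h⟩ := exists_distW_eq R Z
  have hopt := isOptimalSolution_iff.2 ⟨hX, h⟩
  exact ⟨X, hopt, fun Y hY => hY.eq_of_differentiableAt hZ hopt⟩

/-! ### First-order conditions at an optimal solution -/

/-- The residual is orthogonal to every line through the solution inside `W_R(I,J,2)`. -/
theorem IsOptimalSolution.dotProduct_eq_zero {R : ℕ} {Z X H : ThreeWayArray I J 2}
    (hX : IsOptimalSolution R Z X) (hH : ∀ s : ℝ, X + s • H ∈ W I J R) : (Z - X) ⬝ᵥ H = 0 := by
  -- Optimality along the line is nonnegativity of a quadratic in s without constant term, so its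
  -- discriminant forces the linear coefficient to vanish.
  have h : ∀ s : ℝ, 0 ≤ (H ⬝ᵥ H) * (s * s) + (-2 * ((Z - X) ⬝ᵥ H)) * s + 0 := by
    intro s
    have h1 := hX.2 _ (hH s)
    have h2 : Z - (X + s • H) = (Z - X) + (-s) • H := by
      rw [neg_smul]; abel
    rw [h2, frobeniusNorm_sq_add_smul, frobeniusNorm_sq] at h1
    linarith
  have := discrim_le_zero h
  rw [discrim] at this
  nlinarith [sq_nonneg ((Z - X) ⬝ᵥ H)]

variable {R : ℕ} {Z X : ThreeWayArray I J 2}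

/-- Left multiplication by 1 + s·`single i i' 1` does not raise the rank; orthogonality to this line
is the (i, i') entry of the identity. -/
theorem IsOptimalSolution.unfolding_mul_transpose (hX : IsOptimalSolution R Z X) :
    (Z - X).unfolding * X.unfoldingᵀ = 0 := by
  ext i i'
  have h := hX.dotProduct_eq_zero (H := ofUnfolding (single i i' (1 : ℝ) * X.unfolding)) fun s => by
    have : (X + s • ofUnfolding (single i i' (1 : ℝ) * X.unfolding)).unfolding =
        (1 + s • single i i' (1 : ℝ)) * X.unfolding := by
      rw [unfolding_add, unfolding_smul, unfolding_ofUnfolding, Matrix.add_mul, Matrix.one_mul,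
        Matrix.smul_mul]
    show Matrix.rank _ ≤ R
    rw [this]
    exact (rank_mul_le_right _ _).trans hX.1
  rw [dotProduct_ofUnfolding, Finset.sum_eq_single i] at h
  · rw [Matrix.mul_apply]
    simp only [single_mul_apply_same, one_mul] at h
    exact h
  · intro k _ hk
    simp [hk]
  · simp

theorem IsOptimalSolution.transpose_mul_unfolding (hX : IsOptimalSolution R Z X) :
    X.unfoldingᵀ * (Z - X).unfolding = 0 := by
  ext c c'
  have h := hX.dotProduct_eq_zero (H := ofUnfolding (X.unfolding * single c c' (1 : ℝ))) fun s => by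
    have : (X + s • ofUnfolding (X.unfolding * single c c' (1 : ℝ))).unfolding =
        X.unfolding * (1 + s • single c c' (1 : ℝ)) := by
      rw [unfolding_add, unfolding_smul, unfolding_ofUnfolding, Matrix.mul_add, Matrix.mul_one,
        Matrix.mul_smul]
    show Matrix.rank _ ≤ R
    rw [this]
    exact (rank_mul_le_left _ _).trans hX.1
  rw [dotProduct_ofUnfolding] at h
  rw [Matrix.mul_apply, Matrix.zero_apply, ← h]
  refine Finset.sum_congr rfl fun i _ => ?_
  rw [Finset.sum_eq_single c']
  · simp [mul_comm]
  · intro k _ hk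
    simp [hk]
  · simp

/-- Below rank R there is room for any rank-1 perturbation, so the residual would be orthogonal to
every matrix unit and `Z = X`. -/
theorem IsOptimalSolution.rank_unfolding_eq (hX : IsOptimalSolution R Z X)
    (hZ : R ≤ Z.unfolding.rank) : X.unfolding.rank = R := by
  refine le_antisymm hX.1 ?_
  by_contra! hlt
  have h0 : (Z - X).unfolding = 0 := by
    ext i c
    have h := hX.dotProduct_eq_zero (H := ofUnfolding (single i c 1)) fun s => by
      show Matrix.rank _ ≤ R
      rw [unfolding_add, unfolding_smul, unfolding_ofUnfolding]
      refine (rank_add_le_add _ _).trans ?_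
      have : s • single i c (1 : ℝ) = vecMulVec (Pi.single i s) (Pi.single c 1) := by
        ext a b
        simp [single_apply, vecMulVec_apply, Pi.single_apply, ite_and, eq_comm]
        split_ifs <;> rfl
      rw [this]
      have := rank_vecMulVec_le (Pi.single i s : Fin I → ℝ) (Pi.single c 1 : Fin J ⊕ Fin J → ℝ)
      omega
    rw [dotProduct_ofUnfolding, Finset.sum_eq_single i, Finset.sum_eq_single c] at h
    · simpa using h
    · intro k _ hk
      simp [hk.symm]
    · simp
    · intro k _ hk
      simp [hk.symm]
    · simp
  rw [unfolding_sub, sub_eq_zero] at h0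
  rw [h0] at hZ
  omega

end ThreeWayArray

/-! ### The normal map and the exceptional null sets -/

namespace ThreeWayArray

section Chart

variable {I J R p d : ℕ} (f : Fin R ⊕ Fin p ≃ Fin I) (e : Fin R ⊕ Fin d ≃ Fin J ⊕ Fin J)

/-- The unfolding of an array, with rows and columns rearranged. -/
def chartUnfolding (x : ThreeWayArray I J 2) : Matrix (Fin R ⊕ Fin p) (Fin R ⊕ Fin d) ℝ :=
  x.unfolding.submatrix f e

theorem exists_chartUnfolding_eq (M : Matrix (Fin R ⊕ Fin p) (Fin R ⊕ Fin d) ℝ) :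
    ∃ x, chartUnfolding f e x = M :=
  ⟨ofUnfolding (M.submatrix f.symm e.symm), by simp [chartUnfolding]⟩

theorem polynomialOnLines_chartUnfolding (r : Fin R ⊕ Fin p) (c : Fin R ⊕ Fin d) :
    PolynomialOnLines fun x : ThreeWayArray I J 2 => chartUnfolding f e x r c := by
  rcases h : e c with j | j
  · simpa [chartUnfolding, unfolding, slice, h] using PolynomialOnLines.apply (f r, j, (0 : Fin 2))
  · simpa [chartUnfolding, unfolding, slice, h] using PolynomialOnLines.apply (f r, j, (1 : Fin 2))

theorem differentiable_chartUnfolding (r : Fin R ⊕ Fin p) (c : Fin R ⊕ Fin d) :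
    Differentiable ℝ fun x : ThreeWayArray I J 2 => chartUnfolding f e x r c := by
  rcases h : e c with j | j
  · simpa [chartUnfolding, unfolding, slice, h] using
      differentiable_apply (𝕜 := ℝ) (f r, j, (0 : Fin 2))
  · simpa [chartUnfolding, unfolding, slice, h] using
      differentiable_apply (𝕜 := ℝ) (f r, j, (1 : Fin 2))

theorem _root_.Differentiable.matrix_mul {V l m n : Type*} [NormedAddCommGroup V]
    [NormedSpace ℝ V] [Fintype m] {A : V → Matrix l m ℝ} {B : V → Matrix m n ℝ}
    (hA : ∀ i j, Differentiable ℝ fun x => A x i j)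
    (hB : ∀ i j, Differentiable ℝ fun x => B x i j) (i : l) (j : n) :
    Differentiable ℝ fun x => (A x * B x) i j := by
  simp only [Matrix.mul_apply]
  exact Differentiable.fun_sum fun k _ => (hA i k).mul (hB k j)

/-- The sum of the rank-`R` matrix `[1; E] A [1 | C]` and the matrix `[-Eᵀ; 1] D [-Cᵀ | 1]` normal
to the variety of matrices of rank at most `R` at it. -/
def normalForm (M : Matrix (Fin R ⊕ Fin p) (Fin R ⊕ Fin d) ℝ) :
    Matrix (Fin R ⊕ Fin p) (Fin R ⊕ Fin d) ℝ :=
  fromBlocks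
    (M.toBlocks₁₁ + M.toBlocks₂₁ᵀ * M.toBlocks₂₂ * M.toBlocks₁₂ᵀ)
    (M.toBlocks₁₁ * M.toBlocks₁₂ - M.toBlocks₂₁ᵀ * M.toBlocks₂₂)
    (M.toBlocks₂₁ * M.toBlocks₁₁ - M.toBlocks₂₂ * M.toBlocks₁₂ᵀ)
    (M.toBlocks₂₁ * M.toBlocks₁₁ * M.toBlocks₁₂ + M.toBlocks₂₂)

/-- `normalForm` as a map of arrays. -/
def normalMap (x : ThreeWayArray I J 2) : ThreeWayArray I J 2 :=
  ofUnfolding ((normalForm (chartUnfolding f e x)).submatrix f.symm e.symm)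

theorem differentiable_normalMap : Differentiable ℝ (normalMap f e) := by
  have hA : ∀ i j, Differentiable ℝ fun x => (chartUnfolding f e x).toBlocks₁₁ i j :=
    fun i j => differentiable_chartUnfolding f e _ _
  have hC : ∀ i j, Differentiable ℝ fun x => (chartUnfolding f e x).toBlocks₁₂ i j :=
    fun i j => differentiable_chartUnfolding f e _ _
  have hE : ∀ i j, Differentiable ℝ fun x => (chartUnfolding f e x).toBlocks₂₁ i j :=
    fun i j => differentiable_chartUnfolding f e _ _
  have hD : ∀ i j, Differentiable ℝ fun x => (chartUnfolding f e x).toBlocks₂₂ i j :=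
    fun i j => differentiable_chartUnfolding f e _ _
  have hCt : ∀ i j, Differentiable ℝ fun x => (chartUnfolding f e x).toBlocks₁₂ᵀ i j :=
    fun i j => hC j i
  have hEt : ∀ i j, Differentiable ℝ fun x => (chartUnfolding f e x).toBlocks₂₁ᵀ i j :=
    fun i j => hE j i
  have key : ∀ r c, Differentiable ℝ fun x => normalForm (chartUnfolding f e x) r c := by
    rintro (r | r) (c | c)
    · exact (hA r c).add (.matrix_mul (.matrix_mul hEt hD) hCt r c)
    · exact (Differentiable.matrix_mul hA hC r c).sub (.matrix_mul hEt hD r c)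
    · exact (Differentiable.matrix_mul hE hA r c).sub (.matrix_mul hD hCt r c)
    · exact (Differentiable.matrix_mul (.matrix_mul hE hA) hC r c).add (hD r c)
  exact differentiable_pi.2 fun q => key _ _

theorem ae_pencilInvariant_ne_zero (ι : Fin d → Fin J) (hι : Function.Injective ι) (j : Fin J)
    (hj : ∀ i, ι i ≠ j) : ∀ᵐ x : ThreeWayArray I J 2,
      pencilInvariant ι j (chartMatrix e (chartUnfolding f e x).toBlocks₁₂) ≠ 0 := by
  obtain ⟨C, hC⟩ := exists_chartMatrix_pencilInvariant_ne_zero e ι hι j hj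
  obtain ⟨x, hx⟩ := exists_chartUnfolding_eq f e (fromBlocks 0 C 0 0)
  refine PolynomialOnLines.ae_ne_zero volume (PolynomialOnLines.pencilInvariant ?_ ι j)
    (x₀ := x) (by simpa [hx] using hC)
  intro i c
  obtain ⟨c, rfl⟩ := e.surjective c
  rcases c with c | c
  · simpa [chartMatrix, toBlocks₁₂] using
      (polynomialOnLines_chartUnfolding f e (Sum.inl c) (Sum.inr i)).neg
  · simpa [chartMatrix] using PolynomialOnLines.const _

/-- Differentiable maps of a finite-dimensional space to itself send null sets to null sets. -/
theorem ae_not_mem_image_normalMap (ι : Fin d → Fin J) (hι : Function.Injective ι) (j : Fin J)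
    (hj : ∀ i, ι i ≠ j) : ∀ᵐ Z : ThreeWayArray I J 2, Z ∉ normalMap f e ''
      {x | ¬ pencilInvariant ι j (chartMatrix e (chartUnfolding f e x).toBlocks₁₂) ≠ 0} := by
  have h := ae_iff.1 (ae_pencilInvariant_ne_zero f e ι hι j hj)
  exact measure_eq_zero_iff_ae_notMem.1
    (addHaar_image_eq_zero_of_differentiableOn_of_addHaar_eq_zero volume
      (differentiable_normalMap f e).differentiableOn h)

/-- One R × R minor is a polynomial that is not identically zero. -/
theorem ae_le_rank_unfolding (f : Fin R ⊕ Fin p ≃ Fin I) (e : Fin R ⊕ Fin d ≃ Fin J ⊕ Fin J) :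
    ∀ᵐ Z : ThreeWayArray I J 2, R ≤ Z.unfolding.rank := by
  obtain ⟨x, hx⟩ := exists_chartUnfolding_eq f e (fromBlocks 1 0 0 0)
  have h := PolynomialOnLines.ae_ne_zero (volume : Measure (ThreeWayArray I J 2))
    (PolynomialOnLines.det (A := fun Z => (chartUnfolding f e Z).toBlocks₁₁) fun a b =>
      polynomialOnLines_chartUnfolding f e (Sum.inl a) (Sum.inl b)) (x₀ := x) (by simp [hx])
  filter_upwards [h] with Z hZ
  calc R = (chartUnfolding f e Z).toBlocks₁₁.rank := by rw [rank_of_det_ne_zero hZ]; simp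
    _ = (Z.unfolding.submatrix (f ∘ Sum.inl) (e ∘ Sum.inl)).rank := rfl
    _ ≤ Z.unfolding.rank := rank_submatrix_le _ _ _

end Chart

/-- An optimal solution has rank `R`, provided that `Z` avoids the exceptional sets. -/
theorem IsOptimalSolution.rank_eq {I J R p d : ℕ} (hI : I = R + p) (hJ : J + J = R + d)
    {ι : Fin d → Fin J} {j : Fin J} {Z X : ThreeWayArray I J 2} (hX : IsOptimalSolution R Z X)
    (hZ : R ≤ Z.unfolding.rank)
    (hbad : ∀ (f : Fin R ⊕ Fin p ≃ Fin I) (e : Fin R ⊕ Fin d ≃ Fin J ⊕ Fin J),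
      Z ∉ normalMap f e ''
        {x | ¬ pencilInvariant ι j (chartMatrix e (chartUnfolding f e x).toBlocks₁₂) ≠ 0}) :
    X.rank = R := by
  have hXR := hX.rank_unfolding_eq hZ
  refine le_antisymm ?_ (hXR ▸ rank_unfolding_le_rank X)
  obtain ⟨f, e, A, C, E, hA, hXA⟩ := exists_chart X.unfolding (p := p) (d := d) hXR
    (by simpa using hI) (by simpa using hJ)
  obtain ⟨D, hD⟩ := normal_eq_fromBlocks hA C E ((Z - X).unfolding.submatrix f e)
    (by rw [← hXA, transpose_submatrix, submatrix_mul_equiv, hX.unfolding_mul_transpose]; rfl)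
    (by rw [← hXA, transpose_submatrix, submatrix_mul_equiv, hX.transpose_mul_unfolding]; rfl)
  -- The four blocks fill one array `x` of the same shape as `Z`, with `normalMap f e x = Z`.
  obtain ⟨x, hx⟩ := exists_chartUnfolding_eq f e (fromBlocks A C E D)
  refine rank_le_of_chart X f e A C E hXA
    (kernelSpannedByOuter_of_pencilInvariant_ne_zero ι j _ ?_)
  by_contra hzero
  refine hbad f e ⟨x, by simpa [hx] using hzero, ?_⟩
  have hZM : Z.unfolding.submatrix f e = normalForm (fromBlocks A C E D) := by
    have : Z.unfolding.submatrix f e =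
        X.unfolding.submatrix f e + (Z - X).unfolding.submatrix f e := by
      rw [unfolding_sub, submatrix_sub]; simp
    rw [this, hXA, hD, fromBlocks_add, normalForm]
    simp [sub_eq_add_neg]
  rw [normalMap, hx, ← hZM, submatrix_submatrix]
  simpa using ofUnfolding_unfolding Z

end ThreeWayArray

theorem theorem4p1 (I J R : ℕ) (hJ : 2 ≤ J) (hIJ : J < I) (hJR : J < R) (hR : R < min I (2 * J)) :
    ∀ᵐ Z : ThreeWayArray I J 2 ∂MeasureTheory.volume,
      (∃! X : ThreeWayArray I J 2, ThreeWayArray.IsOptimalSolution R Z X) ∧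
        ∀ X : ThreeWayArray I J 2, ThreeWayArray.IsOptimalSolution R Z X → X.rank = R := by
  obtain ⟨hRI, hRJ⟩ := lt_min_iff.1 hR
  obtain ⟨p, hp⟩ := Nat.exists_eq_add_of_le hRI.le
  obtain ⟨d, hd⟩ := Nat.exists_eq_add_of_le (show R ≤ J + J by omega)
  -- Here J < R enters: the first d columns serve as `ι`, and column d is left over for `j`.
  have hdJ : d < J := by omega
  -- The chart depends on X, so all charts are excluded at once; there are only finitely many.
  have hbad := ae_all_iff.2 fun f : Fin R ⊕ Fin p ≃ Fin I =>
    ae_all_iff.2 fun e : Fin R ⊕ Fin d ≃ Fin J ⊕ Fin J =>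
      ThreeWayArray.ae_not_mem_image_normalMap f e (Fin.castLE hdJ.le) (Fin.castLE_injective _)
        ⟨d, hdJ⟩ fun i h => i.2.ne (congrArg Fin.val h)
  have hrank := ThreeWayArray.ae_le_rank_unfolding (I := I) (J := J) (R := R) (p := p) (d := d)
    (Fintype.equivOfCardEq (by simp [hp])) (Fintype.equivOfCardEq (by simp [hd]))
  filter_upwards [hbad, hrank, ThreeWayArray.ae_existsUnique_isOptimalSolution I J R]
    with Z h1 h2 h3
  exact ⟨h3, fun X hX => hX.rank_eq hp hd h2 h1⟩
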